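/- Let $F$ be a field. All algebras are associative unital $F$-algebras, all homomorphisms are unital $F$-algebra homomorphisms, and $\otimes=\otimes_F$. A central simple algebra is a finite-dimensional simple $F$-algebra whose center is $F\cdot 1$. An algebra $S$ is a Skolem–Noether (SN) algebra if for every central simple algebra $R$ and every homomorphism $\varphi:R\to R\otimes S$ there is an invertible element $c\in R\otimes S$ such that $\varphi(x)=c(x\otimes 1)c^{-1}$ for all $x\in R$. An algebra $S$ is semilocal if $S/\mathrm{rad}(S)$ is semisimple, i.e. isomorphic to a finite direct product of simple artinian algebras, where $\mathrm{rad}(S)$ is the Jacobson radical of $S$. Theorem. Every semilocal algebra is an SN algebra. Consequently, every (left or right) artinian algebra is an SN algebra; in particular, every finite-dimensional algebra is an SN algebra. -/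

import Mathlib

open scoped TensorProduct

universe w u v

/-- A ring `S` is semilocal if the quotient of `S` by its Jacobson radical is a semisimple ring
(equivalently, a finite direct product of simple artinian rings). -/
def IsSemilocalAlgebra (S : Type*) [Ring S] : Prop :=
  IsSemisimpleRing (S ⧸ Ring.jacobson S)

/-- An `F`-algebra `S` is a Skolem-Noether algebra if for every central simple (in particular
finite-dimensional) `F`-algebra `R` and every `F`-algebra homomorphism `φ : R → R ⊗ S` there is an
invertible `c` in `R ⊗ S` with `φ x = c (x ⊗ 1) c⁻¹` for all `x` in `R`. -/
def IsSkolemNoetherAlgebra (F : Type u) [Field F] (S : Type v) [Ring S] [Algebra F S] :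
    Prop :=
  ∀ (R : Type w) [Ring R] [Algebra F R] [Algebra.IsCentral F R] [IsSimpleRing R]
    [FiniteDimensional F R] (φ : R →ₐ[F] R ⊗[F] S),
    ∃ c : (R ⊗[F] S)ˣ, ∀ x : R,
      φ x = (c : R ⊗[F] S) * (x ⊗ₜ[F] (1 : S)) * ((c⁻¹ : (R ⊗[F] S)ˣ) : R ⊗[F] S)

/-! Let `A = S ⊗ R` carry the `R`-bimodule structure with left action through `x ↦ 1 ⊗ x` and right
action through `φ`. Since `R ⊗ Rᵐᵒᵖ ≅ End_F(R)`, every bimodule is a sum of copies of `R`. Hence `A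
≅ C ^ d` over `S`, where `d = dim R` and `C` is the `S`-module of intertwiners
(`AlgHom.exists_equiv_pi_intertwiner`). But also `A ≅ S ^ d`. Over a semilocal ring `S ^ d ≅ C ^ d`
forces `S ≅ C` (`IsSemilocalAlgebra.nonempty_equiv_of_pi`): `C` is finitely generated projective,
hence determined modulo the radical, where simple summands cancel. A generator `c` of `C` then makes
`a ↦ a * c` bijective on `A`, so `c` is a unit, and it conjugates `φ` to the inclusion. -/

/-! ### Cancellation for semisimple modules. -/

section SemisimpleCancellation

variable {R : Type*} [Ring R]

/-- Quotients of a semisimple module by isomorphic simple submodules are isomorphic. -/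
theorem IsSemisimpleModule.nonempty_quotient_equiv_of_simple {M : Type*} [AddCommGroup M]
    [Module R M] [IsSemisimpleModule R M] (A B : Submodule R M) [IsSimpleModule R A]
    [IsSimpleModule R B] (e : A ≃ₗ[R] B) : Nonempty ((M ⧸ A) ≃ₗ[R] (M ⧸ B)) := by
  by_cases hAB : A = B
  · subst hAB
    exact ⟨LinearEquiv.refl R _⟩
  have hA : IsAtom A := isSimpleModule_iff_isAtom.mp inferInstance
  have hB : IsAtom B := isSimpleModule_iff_isAtom.mp inferInstance
  have hd : Disjoint A B := hA.disjoint_of_ne hB hAB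
  -- Both quotients have the common part `Z`: `M ⧸ A ≅ B × Z ≅ A × Z ≅ M ⧸ B`.
  obtain ⟨Z, hZ⟩ := exists_isCompl (A ⊔ B)
  have hAZ : Disjoint A Z := hZ.disjoint.mono_left le_sup_left
  have hBZ : Disjoint B Z := hZ.disjoint.mono_left le_sup_right
  have h1 : IsCompl A (B ⊔ Z) :=
    ⟨hd.disjoint_sup_right_of_disjoint_sup_left hZ.disjoint, by
      rw [codisjoint_iff, ← sup_assoc, hZ.sup_eq_top]⟩
  have h2 : IsCompl B (A ⊔ Z) :=
    ⟨hd.symm.disjoint_sup_right_of_disjoint_sup_left (by rw [sup_comm]; exact hZ.disjoint), by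
      rw [codisjoint_iff, ← sup_assoc, sup_comm B, hZ.sup_eq_top]⟩
  have prodEquiv (C : Submodule R M) (hC : Disjoint C Z) : Nonempty ((C × Z) ≃ₗ[R] ↥(C ⊔ Z)) := by
    let f : (C × Z) →ₗ[R] M := C.subtype.coprod Z.subtype
    have hf : Function.Injective f := by
      rw [← LinearMap.ker_eq_bot]
      exact LinearMap.ker_coprod_of_disjoint_range _ _ (by simpa using hC) |>.trans (by simp)
    refine ⟨(LinearEquiv.ofInjective f hf).trans (LinearEquiv.ofEq _ _ ?_)⟩
    simp [f, LinearMap.range_coprod]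
  obtain ⟨u⟩ := prodEquiv A hAZ
  obtain ⟨v⟩ := prodEquiv B hBZ
  exact ⟨(Submodule.quotientEquivOfIsCompl _ _ h1).trans <| v.symm.trans <|
    (e.symm.prodCongr (LinearEquiv.refl R Z)).trans <| u.trans
    (Submodule.quotientEquivOfIsCompl _ _ h2).symm⟩

theorem IsSemisimpleModule.prod (M N : Type*) [AddCommGroup M] [AddCommGroup N] [Module R M]
    [Module R N] [IsSemisimpleModule R M] [IsSemisimpleModule R N] :
    IsSemisimpleModule R (M × N) := by
  have := IsSemisimpleModule.range (LinearMap.inl R M N)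
  have := IsSemisimpleModule.range (LinearMap.inr R M N)
  have h := IsSemisimpleModule.sup (p := LinearMap.range (LinearMap.inl R M N))
    (q := LinearMap.range (LinearMap.inr R M N)) inferInstance inferInstance
  rw [LinearMap.sup_range_inl_inr] at h
  exact h.congr Submodule.topEquiv.symm

/-- A simple factor can be cancelled from a product of semisimple modules. -/
theorem IsSemisimpleModule.nonempty_equiv_of_prod_simple {T X Y : Type*} [AddCommGroup T]
    [AddCommGroup X] [AddCommGroup Y] [Module R T] [Module R X] [Module R Y] [IsSimpleModule R T]
    [IsSemisimpleModule R Y] (f : (T × X) ≃ₗ[R] (T × Y)) : Nonempty (X ≃ₗ[R] Y) := by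
  have : IsSemisimpleModule R (T × Y) := .prod T Y
  let K : Submodule R (T × X) := LinearMap.ker (LinearMap.snd R T X)
  let L : Submodule R (T × Y) := LinearMap.ker (LinearMap.snd R T Y)
  let eK : T ≃ₗ[R] K := (LinearEquiv.ofInjective (LinearMap.inl R T X)
    LinearMap.inl_injective).trans (LinearEquiv.ofEq _ _ (LinearMap.range_inl ..))
  let eL : T ≃ₗ[R] L := (LinearEquiv.ofInjective (LinearMap.inl R T Y)
    LinearMap.inl_injective).trans (LinearEquiv.ofEq _ _ (LinearMap.range_inl ..))
  let K' : Submodule R (T × Y) := K.map (f : (T × X) →ₗ[R] (T × Y))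
  let eK' : K ≃ₗ[R] K' := f.submoduleMap K
  have := IsSimpleModule.congr eK.symm
  have := IsSimpleModule.congr eL.symm
  have := IsSimpleModule.congr eK'.symm
  obtain ⟨q⟩ := IsSemisimpleModule.nonempty_quotient_equiv_of_simple K' L
    (eK'.symm.trans (eK.symm.trans eL))
  exact ⟨(LinearMap.quotKerEquivOfSurjective _ LinearMap.snd_surjective).symm.trans <|
    (Submodule.Quotient.equiv K K' f rfl).trans <| q.trans
    (LinearMap.quotKerEquivOfSurjective _ LinearMap.snd_surjective)⟩

theorem IsSemisimpleModule.nonempty_equiv_of_pi_simple_prod {T X Y : Type*} [AddCommGroup T]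
    [AddCommGroup X] [AddCommGroup Y] [Module R T] [Module R X] [Module R Y] [IsSimpleModule R T]
    [IsSemisimpleModule R Y] (n : ℕ)
    (f : ((Fin n → T) × X) ≃ₗ[R] ((Fin n → T) × Y)) : Nonempty (X ≃ₗ[R] Y) := by
  induction n with
  | zero => exact ⟨LinearEquiv.uniqueProd.symm.trans (f.trans LinearEquiv.uniqueProd)⟩
  | succ n ih =>
    let c := Fin.consLinearEquiv R (fun _ : Fin (n + 1) ↦ T)
    have : IsSemisimpleModule R ((Fin n → T) × Y) := .prod _ _
    let g : (T × ((Fin n → T) × X)) ≃ₗ[R] (T × ((Fin n → T) × Y)) :=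
      (LinearEquiv.prodAssoc R T (Fin n → T) X).symm.trans <|
      (c.prodCongr (.refl R X)).trans <| f.trans <|
      (c.symm.prodCongr (.refl R Y)).trans (LinearEquiv.prodAssoc R T (Fin n → T) Y)
    obtain ⟨h⟩ := IsSemisimpleModule.nonempty_equiv_of_prod_simple g
    exact ih h

/-- Families of pairs are pairs of families. -/
def LinearEquiv.piProdEquiv (R ι M N : Type*) [Ring R] [AddCommGroup M] [AddCommGroup N]
    [Module R M] [Module R N] : (ι → M × N) ≃ₗ[R] ((ι → M) × (ι → N)) where
  toFun v := (fun i ↦ (v i).1, fun i ↦ (v i).2)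
  invFun v i := (v.1 i, v.2 i)
  map_add' _ _ := rfl
  map_smul' _ _ := rfl

/-- Finite powers of semisimple modules of finite length determine the modules. -/
theorem IsSemisimpleModule.nonempty_equiv_of_pi {M N : Type*} [AddCommGroup M] [AddCommGroup N]
    [Module R M] [Module R N] [IsSemisimpleModule R M] [IsSemisimpleModule R N]
    [Module.Finite R M] {d : ℕ} [NeZero d] (f : (Fin d → M) ≃ₗ[R] (Fin d → N)) :
    Nonempty (M ≃ₗ[R] N) := by
  obtain ⟨n, hn⟩ : ∃ n : ℕ, Module.length R M = n :=
    ⟨_, (ENat.natCast_toNat Module.length_ne_top).symm⟩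
  -- Finite length is now carried by `hn`, so the induction need not preserve finiteness separately.
  clear ‹Module.Finite R M›
  induction n using Nat.strong_induction_on generalizing M N with
  | _ n ih =>
  rcases subsingleton_or_nontrivial M with hM | hM
  · have : Subsingleton (Fin d → N) := f.symm.toEquiv.subsingleton
    have : Subsingleton N := (Function.const_injective (α := Fin d)).subsingleton
    exact ⟨LinearEquiv.ofSubsingleton M N⟩
  obtain ⟨T, hT⟩ := IsSemisimpleModule.exists_simple_submodule R M
  have := IsSimpleModule.nontrivial R T
  obtain ⟨t, ht⟩ := exists_ne (0 : T)
  -- Some coordinate of `f` is nonzero on the diagonal copy of `T`; as `T` is simple, it embeds in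
  -- `N`.
  obtain ⟨j, hj⟩ : ∃ j, f (Function.const _ (t : M)) j ≠ 0 := by
    by_contra! h
    have h0 : f (Function.const _ (t : M)) = 0 := funext h
    rw [LinearEquiv.map_eq_zero_iff] at h0
    exact ht (Subtype.ext (congrFun h0 0))
  let g : T →ₗ[R] N := (LinearMap.proj j) ∘ₗ (f : (Fin d → M) →ₗ[R] (Fin d → N)) ∘ₗ
    (LinearMap.pi fun _ ↦ T.subtype)
  have hg : g ≠ 0 := fun h ↦ hj (by simpa [g] using! congr($h t))
  let eT : T ≃ₗ[R] LinearMap.range g := LinearEquiv.ofInjective g (LinearMap.injective_of_ne_zero hg)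
  obtain ⟨X, hX⟩ := exists_isCompl T
  obtain ⟨Y, hY⟩ := exists_isCompl (LinearMap.range g)
  let eM : (T × X) ≃ₗ[R] M := Submodule.prodEquivOfIsCompl _ _ hX
  let eN : (T × Y) ≃ₗ[R] N := (eT.prodCongr (.refl R Y)).trans
    (Submodule.prodEquivOfIsCompl _ _ hY)
  -- Cancelling `T ^ d` leaves `X ^ d ≅ Y ^ d`, with `X` one shorter than `M`.
  obtain ⟨h⟩ := IsSemisimpleModule.nonempty_equiv_of_pi_simple_prod d <|
    (LinearEquiv.piProdEquiv R (Fin d) T X).symm.trans <| (LinearEquiv.piCongrRight fun _ ↦ eM).trans <| f.trans <|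
    (LinearEquiv.piCongrRight fun _ ↦ eN.symm).trans (LinearEquiv.piProdEquiv R (Fin d) T Y)
  have hl : (Module.length R X) + 1 = n := by
    rw [← hn, ← eM.length_eq, Module.length_prod, Module.length_eq_one R T, add_comm]
  obtain ⟨m, hm⟩ : ∃ m : ℕ, Module.length R X = m := by
    refine ⟨_, (ENat.natCast_toNat fun h ↦ ?_).symm⟩
    simp [h] at hl
  rw [hm] at hl
  obtain ⟨k⟩ := ih m (by have : m + 1 = n := by exact_mod_cast hl
                         omega) h hm
  exact ⟨eM.symm.trans <| (LinearEquiv.prodCongr (.refl R T) k).trans eN⟩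

end SemisimpleCancellation

/-! ### Lifting isomorphisms modulo the radical. -/

section Semilocal

variable {R : Type*} [Ring R]

theorem Module.jacobson_pi_const {ι : Type*} [Finite ι] (M : Type*) [AddCommGroup M] [Module R M] :
    Module.jacobson R (ι → M) = Submodule.pi Set.univ (fun _ ↦ Module.jacobson R M) := by
  classical
  have := Fintype.ofFinite ι
  refine le_antisymm (Module.jacobson_pi_le R _) fun v hv ↦ ?_
  rw [← Finset.univ_sum_single v]
  exact Submodule.sum_mem _ fun i _ ↦
    Module.le_comap_jacobson (LinearMap.single R (fun _ ↦ M) i) (hv i trivial)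

/-- The quotient by the radical commutes with finite powers. -/
noncomputable def Module.quotientJacobsonPi (R ι M : Type*) [Ring R] [Finite ι] [AddCommGroup M]
    [Module R M] :
    ((ι → M) ⧸ Module.jacobson R (ι → M)) ≃ₗ[R] (ι → M ⧸ Module.jacobson R M) :=
  (Submodule.quotEquivOfEq _ _ (by
    ext v
    simp [Module.jacobson_pi_const, funext_iff])).trans <|
  LinearMap.quotKerEquivOfSurjective
    (LinearMap.pi fun i ↦ (Module.jacobson R M).mkQ ∘ₗ LinearMap.proj (φ := fun _ : ι ↦ M) i)
    fun v ↦ ⟨fun i ↦ (v i).out, funext fun i ↦ Submodule.Quotient.mk_out (v i)⟩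

/-- An endomorphism that is the identity modulo the radical is surjective. -/
theorem LinearMap.surjective_of_sub_mem_jacobson {M : Type*} [AddCommGroup M] [Module R M]
    [Module.Finite R M] (h : M →ₗ[R] M) (hh : ∀ m, h m - m ∈ Module.jacobson R M) :
    Function.Surjective h := by
  rw [← LinearMap.range_eq_top]
  by_contra hne
  obtain ⟨m, hm, hle⟩ := (eq_top_or_exists_le_coatom (LinearMap.range h)).resolve_left hne
  refine hm.1 (eq_top_iff.mpr fun x _ ↦ ?_)
  have h1 : h x - x ∈ m := Submodule.mem_sInf.mp (hh x) m hm
  simpa using m.sub_mem (hle ⟨x, rfl⟩) h1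

/-- Projectivity splits the surjection `h`. The section is again the identity modulo the radical,
hence surjective, which makes `h` injective. -/
theorem LinearMap.bijective_of_sub_mem_jacobson {M : Type*} [AddCommGroup M] [Module R M]
    [Module.Finite R M] [Module.Projective R M] (h : M →ₗ[R] M)
    (hh : ∀ m, h m - m ∈ Module.jacobson R M) : Function.Bijective h := by
  have hs := LinearMap.surjective_of_sub_mem_jacobson h hh
  obtain ⟨g, hg⟩ := Module.projective_lifting_property h LinearMap.id hs
  have hg' (m : M) : h (g m) = m := congr($hg m)
  have hgs : Function.Surjective g := LinearMap.surjective_of_sub_mem_jacobson g fun m ↦ by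
    simpa [hg'] using neg_mem (hh (g m))
  exact ⟨(Function.LeftInverse.rightInverse_of_surjective hg' hgs).injective, hs⟩

/-- Finitely generated projective modules are determined by their quotients modulo the radical. -/
theorem Module.Projective.nonempty_equiv_of_quotient_jacobson {P Q : Type*} [AddCommGroup P]
    [AddCommGroup Q] [Module R P] [Module R Q] [Module.Finite R P] [Module.Finite R Q]
    [Module.Projective R P] [Module.Projective R Q]
    (e : (P ⧸ Module.jacobson R P) ≃ₗ[R] (Q ⧸ Module.jacobson R Q)) : Nonempty (P ≃ₗ[R] Q) := by
  obtain ⟨f, hf⟩ := Module.projective_lifting_property (Module.jacobson R Q).mkQ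
    (e.toLinearMap ∘ₗ (Module.jacobson R P).mkQ) (Submodule.mkQ_surjective _)
  obtain ⟨g, hg⟩ := Module.projective_lifting_property (Module.jacobson R P).mkQ
    (e.symm.toLinearMap ∘ₗ (Module.jacobson R Q).mkQ) (Submodule.mkQ_surjective _)
  have hf' (x : P) : (Submodule.Quotient.mk (f x) : Q ⧸ Module.jacobson R Q) =
    e (Submodule.Quotient.mk x) := congr($hf x)
  have hg' (x : Q) : (Submodule.Quotient.mk (g x) : P ⧸ Module.jacobson R P) =
    e.symm (Submodule.Quotient.mk x) := congr($hg x)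
  have h1 : Function.Bijective (g ∘ₗ f) := LinearMap.bijective_of_sub_mem_jacobson _ fun m ↦ by
    rw [← Submodule.Quotient.eq, LinearMap.comp_apply, hg', hf', e.symm_apply_apply]
  have h2 : Function.Bijective (f ∘ₗ g) := LinearMap.bijective_of_sub_mem_jacobson _ fun m ↦ by
    rw [← Submodule.Quotient.eq, LinearMap.comp_apply, hf', hg', e.apply_symm_apply]
  exact ⟨LinearEquiv.ofBijective f ⟨Function.Injective.of_comp h1.1, Function.Surjective.of_comp h2.2⟩⟩

/-- Over a semilocal ring, a module some positive power of which is free of the same rank is free of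
rank one. -/
theorem IsSemilocalAlgebra.nonempty_equiv_of_pi (hR : IsSemilocalAlgebra R) {P : Type*}
    [AddCommGroup P] [Module R P] {d : ℕ} [NeZero d] (f : (Fin d → R) ≃ₗ[R] (Fin d → P)) :
    Nonempty (R ≃ₗ[R] P) := by
  have : IsSemisimpleRing (R ⧸ Ring.jacobson R) := hR
  have : IsSemisimpleModule R (R ⧸ Module.jacobson R R) :=
    (LinearMap.isSemisimpleModule_iff_of_bijective (σ := Ideal.Quotient.mk (Ring.jacobson R))
      (N' := R ⧸ Ring.jacobson R)
      { toFun := fun x : R ⧸ Module.jacobson R R ↦ (x : R ⧸ Ring.jacobson R)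
        map_add' := fun _ _ ↦ rfl
        map_smul' := by
          intro r x
          obtain ⟨x, rfl⟩ := Submodule.Quotient.mk_surjective _ x
          rfl } Function.bijective_id).mpr inferInstance
  -- `P` is a direct summand of `P ^ d ≅ R ^ d`.
  have : Module.Finite R (Fin d → P) := Module.Finite.equiv f
  have : Module.Projective R (Fin d → P) := Module.Projective.of_equiv f
  have : Module.Finite R P := Module.Finite.of_surjective
    (LinearMap.proj (R := R) (φ := fun _ : Fin d ↦ P) 0) (LinearMap.proj_surjective 0)
  have : Module.Projective R P := Module.Projective.of_split
    (LinearMap.single R (fun _ ↦ P) (0 : Fin d)) (LinearMap.proj 0) (by ext; simp)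
  let q : (Fin d → R ⧸ Module.jacobson R R) ≃ₗ[R] (Fin d → P ⧸ Module.jacobson R P) :=
    (Module.quotientJacobsonPi R (Fin d) R).symm.trans <| (Submodule.Quotient.equiv _ _ f
      (Module.map_jacobson_of_bijective f.bijective)).trans <|
    Module.quotientJacobsonPi R (Fin d) P
  have : IsSemisimpleModule R (P ⧸ Module.jacobson R P) :=
    .of_injective (q.symm.toLinearMap ∘ₗ LinearMap.pi fun _ ↦ LinearMap.id)
      (q.symm.injective.comp fun _ _ h ↦ congrFun h 0)
  obtain ⟨u⟩ := IsSemisimpleModule.nonempty_equiv_of_pi q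
  exact Module.Projective.nonempty_equiv_of_quotient_jacobson u

end Semilocal

/-! ### Left-right symmetry of semilocality. -/

section MulOpposite

variable {R : Type*} [Ring R]

theorem Ring.isUnit_one_add_of_mem_jacobson {x : R} (hx : x ∈ Ring.jacobson R) :
    IsUnit (1 + x) := by
  have key (x : R) (hx : x ∈ Ring.jacobson R) : ∃ u, u * (1 + x) = 1 := by
    obtain ⟨u, hu⟩ := LinearMap.surjective_of_sub_mem_jacobson
      (LinearMap.toSpanSingleton R R (1 + x)) (fun m ↦ by
        simpa [mul_add] using Ideal.mul_mem_left (Ring.jacobson R) m hx) 1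
    exact ⟨u, hu⟩
  obtain ⟨u, hu⟩ := key x hx
  -- The left inverse `u = 1 - u * x` has the same form, so it has a left inverse too.
  obtain ⟨v, hv⟩ := key (-(u * x)) (neg_mem (Ideal.mul_mem_left _ u hx))
  have h1 : 1 + -(u * x) = u := by
    rw [mul_add, mul_one] at hu
    rw [← hu]
    abel
  rw [h1] at hv
  have h2 : v = 1 + x := left_inv_eq_right_inv hv hu
  exact ⟨⟨1 + x, u, h2 ▸ hv, hu⟩, rfl⟩

theorem Ring.le_jacobson_of_isUnit_one_add (I : Ideal R) (hI : ∀ x ∈ I, IsUnit (1 + x)) :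
    I ≤ Ring.jacobson R := by
  rw [Ring.jacobson_eq_sInf_isMaximal]
  refine le_sInf fun m hm ↦ ?_
  by_contra hle
  have hm' : m.IsMaximal := hm
  have htop : m ⊔ I = ⊤ := hm'.out.2 _ (left_lt_sup.mpr hle)
  obtain ⟨y, hy, z, hz, hyz⟩ := Submodule.mem_sup.mp (htop ▸ Submodule.mem_top : (1 : R) ∈ m ⊔ I)
  have hu := hI (-z) (neg_mem hz)
  rw [show 1 + -z = y by rw [← hyz]; abel] at hu
  exact hm'.ne_top (Ideal.eq_top_of_isUnit_mem _ hy hu)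

/-- The radical is characterised by `1 + x` being a unit, a condition insensitive to the order of
multiplication. This brings in right artinian algebras. -/
theorem IsSemilocalAlgebra.of_mulOpposite (h : IsSemilocalAlgebra Rᵐᵒᵖ) :
    IsSemilocalAlgebra R := by
  have : IsSemisimpleRing (Rᵐᵒᵖ ⧸ Ring.jacobson Rᵐᵒᵖ) := h
  let f : R →+* (Rᵐᵒᵖ ⧸ Ring.jacobson Rᵐᵒᵖ)ᵐᵒᵖ :=
    (Ideal.Quotient.mk (Ring.jacobson Rᵐᵒᵖ)).op.comp (RingEquiv.opOp R).toRingHom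
  have hf : Function.Surjective f := by
    intro x
    obtain ⟨y, hy⟩ := Ideal.Quotient.mk_surjective x.unop
    exact ⟨y.unop, MulOpposite.unop_injective hy⟩
  have hmem (x : R) (hx : x ∈ RingHom.ker f) : MulOpposite.op x ∈ Ring.jacobson Rᵐᵒᵖ :=
    Ideal.Quotient.eq_zero_iff_mem.mp (MulOpposite.op_injective hx)
  have hker : RingHom.ker f = Ring.jacobson R := by
    refine le_antisymm (Ring.le_jacobson_of_isUnit_one_add _ fun x hx ↦ ?_) ?_
    · exact isUnit_op.mp (Ring.isUnit_one_add_of_mem_jacobson (hmem x hx))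
    · have := RingHomSurjective.mk hf
      have := Ring.le_comap_jacobson f
      rwa [IsSemisimpleRing.jacobson_eq_bot (Rᵐᵒᵖ ⧸ Ring.jacobson Rᵐᵒᵖ)ᵐᵒᵖ] at this
  exact ((Ideal.quotEquivOfEq hker.symm).trans
    (RingHom.quotientKerEquivOfSurjective hf)).symm.isSemisimpleRing

end MulOpposite

/-! ### The enveloping algebra of a central simple algebra. -/

section Azumaya

open Module (Basis finBasis finrank finrank_pos)

variable (F : Type*) [Field F] (R : Type*) [Ring R] [Algebra F R]

/-- For a finite-dimensional central simple algebra, the enveloping algebra is the full algebra of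
linear endomorphisms. -/
theorem AlgHom.mulLeftRight_bijective_of_isCentral_of_isSimpleRing [Algebra.IsCentral F R]
    [IsSimpleRing R] [FiniteDimensional F R] : Function.Bijective (AlgHom.mulLeftRight F R) := by
  let _ : Module (R ⊗[F] Rᵐᵒᵖ) R := TensorProduct.Algebra.module
  have hsmul (t : R ⊗[F] Rᵐᵒᵖ) (x : R) : t • x = AlgHom.mulLeftRight F R t x := rfl
  have htmul (a b x : R) : (a ⊗ₜ[F] MulOpposite.op b) • x = a * x * b := by
    rw [hsmul, AlgHom.mulLeftRight_apply]; rfl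
  -- Submodules over the enveloping algebra are two-sided ideals.
  have : IsSimpleModule (R ⊗[F] Rᵐᵒᵖ) R := by
    have : Nontrivial (Submodule (R ⊗[F] Rᵐᵒᵖ) R) := Submodule.nontrivial_iff _ |>.mpr inferInstance
    rw [isSimpleModule_iff]
    refine ⟨fun N ↦ ?_⟩
    let I : TwoSidedIdeal R := .mk' (N : Set R) N.zero_mem N.add_mem N.neg_mem
      (fun {x y} hy ↦ by
        have h := N.smul_mem (x ⊗ₜ MulOpposite.op 1) hy
        rwa [htmul, mul_one] at h)
      (fun {x y} hx ↦ by
        have h := N.smul_mem (1 ⊗ₜ MulOpposite.op y) hx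
        rwa [htmul, one_mul] at h)
    have hI (x : R) : x ∈ I ↔ x ∈ N := TwoSidedIdeal.mem_mk' ..
    rcases eq_bot_or_eq_top I with h | h
    · left
      ext x
      rw [← hI, h]
      simp
    · right
      ext x
      rw [← hI, h]
      simp
  -- An endomorphism is multiplication by the central element `g 1`; thus every `F`-linear map
  -- commutes with all of them, and density applies.
  have hcomm (g : Module.End (R ⊗[F] Rᵐᵒᵖ) R) : ∃ r : F, ∀ x, g x = r • x := by
    have h1 (x : R) : g x = x * g 1 := by
      have h := g.map_smul (x ⊗ₜ MulOpposite.op 1) 1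
      rwa [htmul, htmul, mul_one, mul_one, mul_one] at h
    have h2 (x : R) : g x = g 1 * x := by
      have h := g.map_smul (1 ⊗ₜ MulOpposite.op x) 1
      rwa [htmul, htmul, one_mul, one_mul, one_mul] at h
    obtain ⟨r, hr⟩ := Algebra.IsCentral.mem_center_iff F |>.mp
      (Subalgebra.mem_center_iff.mpr fun x ↦ (h1 x).symm.trans (h2 x) : g 1 ∈ Subalgebra.center F R)
    exact ⟨r, fun x ↦ by rw [h2, hr, Algebra.smul_def]⟩
  classical
  have hsurj : Function.Surjective (AlgHom.mulLeftRight F R) := by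
    intro f
    let f' : Module.End (Module.End (R ⊗[F] Rᵐᵒᵖ) R) R :=
      { toFun := f
        map_add' := f.map_add
        map_smul' := fun g x ↦ by
          obtain ⟨r, hr⟩ := hcomm g
          simp [hr] }
    obtain ⟨t, ht⟩ := jacobson_density f' (Finset.univ.image (finBasis F R))
    refine ⟨t, (finBasis F R).ext fun i ↦ ?_⟩
    exact (ht _ (Finset.mem_image_of_mem _ (Finset.mem_univ i))).symm
  refine ⟨?_, hsurj⟩
  refine (LinearMap.injective_iff_surjective_of_finrank_eq_finrank
    (f := (AlgHom.mulLeftRight F R).toLinearMap) ?_).mpr hsurj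
  rw [Module.finrank_tensorProduct, Module.finrank_linearMap,
    ← (MulOpposite.opLinearEquiv F : R ≃ₗ[F] Rᵐᵒᵖ).finrank_eq]

end Azumaya

/-! ### Intertwiners and the bimodule decomposition. -/

section Intertwiner

open Module (Basis finBasis finrank finrank_pos)

variable {F : Type*} [Field F] {R : Type*} [Ring R] [Algebra F R] {A : Type*} [Ring A] [Algebra F A]

/-- The action of the enveloping algebra of `R` on `A` through two homomorphisms. -/
def AlgHom.bimodule (α β : R →ₐ[F] A) : (R ⊗[F] Rᵐᵒᵖ) →ₐ[F] Module.End F A :=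
  Algebra.TensorProduct.lift ((Algebra.lmul F A).comp α)
    ((AlgHom.ofLinearMap ((LinearMap.mul F A).flip ∘ₗ β.toLinearMap ∘ₗ
      (MulOpposite.opLinearEquiv F).symm.toLinearMap) (by ext; simp)
      (fun x y ↦ by ext; simp [mul_assoc])))
    (fun x y ↦ (commute_iff_eq _ _).mpr (LinearMap.ext fun a ↦ by simp [mul_assoc]))

@[simp]
theorem AlgHom.bimodule_tmul (α β : R →ₐ[F] A) (x : R) (y : Rᵐᵒᵖ) (a : A) :
    AlgHom.bimodule α β (x ⊗ₜ y) a = α x * (a * β y.unop) := by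
  rw [AlgHom.bimodule, Algebra.TensorProduct.lift_tmul]
  simp

variable {S : Type*} [Ring S] [Module S A] [IsScalarTower S A A]

/-- The elements intertwining two homomorphisms. -/
def AlgHom.intertwiner (S : Type*) [Ring S] [Module S A] [IsScalarTower S A A] (α β : R →ₐ[F] A)
    (hα : ∀ x (s : S) a, α x * (s • a) = s • (α x * a)) : Submodule S A where
  carrier := {c | ∀ x, c * β x = α x * c}
  add_mem' h h' x := by rw [add_mul, mul_add, h x, h' x]
  zero_mem' x := by simp
  smul_mem' s c h x := by rw [smul_mul_assoc, h x, hα]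

variable (α β : R →ₐ[F] A)

/-- For an intertwiner `c`, the map `r ↦ α r * c` is a bimodule map from `R` to `A`. -/
theorem AlgHom.bimodule_apply_of_mem_intertwiner (t : R ⊗[F] Rᵐᵒᵖ) (r : R) {c : A}
    (hc : ∀ x, c * β x = α x * c) :
    AlgHom.bimodule α β t (α r * c) = α (AlgHom.mulLeftRight F R t r) * c := by
  induction t with
  | zero => simp
  | add t t' h h' => simp [h, h', add_mul]
  | tmul x y => simp [mul_assoc, hc]

/-- A bimodule over a central simple algebra is a power of its submodule of intertwiners. -/
theorem AlgHom.exists_equiv_pi_intertwiner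
    (hα : ∀ x (s : S) a, α x * (s • a) = s • (α x * a)) {ι : Type*} [Fintype ι] (b : Basis ι F R)
    (hR : Function.Bijective (AlgHom.mulLeftRight F R)) :
    ∃ e : (ι → AlgHom.intertwiner S α β hα) ≃ₗ[S] A, ∀ c, e c = ∑ i, α (b i) * (c i : A) := by
  classical
  -- `t i` acts on `R` as `y ↦ (b.coord i y) • 1`. Its values are central, so `t i` sends `A` into
  -- the intertwiners (`hcomm`); the basis expansion gives `hsum`. The inverse map is therefore `a ↦
  -- (t i · a)`.
  choose t ht using fun i ↦ hR.2 ((b.coord i).smulRight (1 : R))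
  have hcomm (i : ι) (x : R) : x ⊗ₜ 1 * t i = 1 ⊗ₜ MulOpposite.op x * t i := hR.1 <| by
    ext y
    simp [ht]
  have hsum : ∑ i, (b i) ⊗ₜ 1 * t i = 1 := hR.1 <| by
    ext y
    simp [ht, b.sum_repr]
  let f : (ι → AlgHom.intertwiner S α β hα) →ₗ[S] A :=
    { toFun := fun c ↦ ∑ i, α (b i) * (c i : A)
      map_add' := fun c c' ↦ by simp [mul_add, Finset.sum_add_distrib]
      map_smul' := fun s c ↦ by simp [hα, Finset.smul_sum] }
  refine ⟨LinearEquiv.ofBijective f (Function.bijective_iff_has_inverse.mpr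
    ⟨fun a i ↦ ⟨AlgHom.bimodule α β (t i) a, fun x ↦ ?_⟩, fun c ↦ ?_, fun a ↦ ?_⟩), fun c ↦ rfl⟩
  · have := congr(AlgHom.bimodule α β $(hcomm i x) a)
    simpa using this.symm
  · ext i
    simp only [f, LinearMap.coe_mk, AddHom.coe_mk, map_sum]
    rw [Finset.sum_eq_single i _ (by simp)]
    · rw [AlgHom.bimodule_apply_of_mem_intertwiner α β _ _ (c i).2, ht]
      simp
    · intro j _ hj
      rw [AlgHom.bimodule_apply_of_mem_intertwiner α β _ _ (c j).2, ht]
      simp [hj]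
  · have := congr(AlgHom.bimodule α β $hsum a)
    simpa [f, map_sum] using this

/-- Over a semilocal ring, a free bimodule over a central simple algebra has an invertible
intertwiner. -/
theorem AlgHom.exists_unit_intertwiner
    (hα : ∀ x (s : S) a, α x * (s • a) = s • (α x * a)) (hS : IsSemilocalAlgebra S) [Nontrivial R]
    [FiniteDimensional F R] (hR : Function.Bijective (AlgHom.mulLeftRight F R))
    (B : Basis (Fin (finrank F R)) S A) (hB : ∀ i, B i = α (finBasis F R i)) :
    ∃ c : Aˣ, ∀ x, c * β x = α x * c := by
  obtain ⟨e, he⟩ := AlgHom.exists_equiv_pi_intertwiner α β hα (finBasis F R) hR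
  have : NeZero (finrank F R) := ⟨finrank_pos.ne'⟩
  obtain ⟨u⟩ := hS.nonempty_equiv_of_pi (B.equivFun.symm.trans e.symm)
  set c : A := (u 1 : A) with hc
  have hu (s : S) : (u s : A) = s • c := by
    rw [hc, ← Submodule.coe_smul, ← map_smul, smul_eq_mul, mul_one]
  -- Expanding `a` in `B` shows that right multiplication by `c` is a composite of isomorphisms.
  have hmul (a : A) : a * c = (B.equivFun.trans ((LinearEquiv.piCongrRight fun _ ↦ u).trans e)) a := by
    conv_lhs => rw [← B.sum_equivFun a]
    simp [he, hu, hα, hB, Finset.sum_mul, smul_mul_assoc]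
  have hbij : Function.Bijective (fun a ↦ a * c) := by
    simp_rw [hmul]
    exact LinearEquiv.bijective _
  obtain ⟨d, hd⟩ := hbij.2 1
  have hd' : c * d = 1 := hbij.1 (by simpa [mul_assoc] using congr(c * $hd))
  exact ⟨⟨c, d, hd', hd⟩, fun x ↦ (u 1).2 x⟩

end Intertwiner

/-! ### The Skolem–Noether property. -/

theorem IsSemilocalAlgebra.isSkolemNoetherAlgebra (F : Type u) [Field F] {S : Type v} [Ring S]
    [Algebra F S] (hS : IsSemilocalAlgebra S) : IsSkolemNoetherAlgebra.{w} F S := by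
  intro R _ _ _ _ _ φ
  -- The factors are swapped so that `S` acts on the left and `Algebra.TensorProduct.basis` applies.
  let σ : (R ⊗[F] S) ≃ₐ[F] (S ⊗[F] R) := Algebra.TensorProduct.comm F R S
  have hα (x : R) (s : S) (a : S ⊗[F] R) :
      (Algebra.TensorProduct.includeRight : R →ₐ[F] S ⊗[F] R) x * (s • a) =
      s • ((Algebra.TensorProduct.includeRight : R →ₐ[F] S ⊗[F] R) x * a) := by
    induction a with
    | zero => simp
    | add a a' h h' => simp only [smul_add, mul_add, h, h']
    | tmul s' r => simp [TensorProduct.smul_tmul']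
  obtain ⟨c, hc⟩ := AlgHom.exists_unit_intertwiner
    (Algebra.TensorProduct.includeRight : R →ₐ[F] S ⊗[F] R) (σ.toAlgHom.comp φ) hα hS
    (AlgHom.mulLeftRight_bijective_of_isCentral_of_isSimpleRing F R)
    (Algebra.TensorProduct.basis S (Module.finBasis F R)) (by simp)
  let d : (R ⊗[F] S)ˣ := Units.map (σ.symm : (S ⊗[F] R) →* (R ⊗[F] S)) c
  refine ⟨d⁻¹, fun x ↦ ?_⟩
  have h : (d : R ⊗[F] S) * φ x = (x ⊗ₜ[F] (1 : S)) * (d : R ⊗[F] S) := by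
    simpa [d, σ] using congr(σ.symm $(hc x))
  rw [inv_inv, mul_assoc, ← h, Units.inv_mul_cancel_left]

theorem IsSemilocalAlgebra.of_isArtinianRing (S : Type*) [Ring S] [IsArtinianRing S] :
    IsSemilocalAlgebra S := IsSemiprimaryRing.isSemisimpleRing

theorem theorem5p5 (F : Type u) [Field F] (S : Type v) [Ring S] [Algebra F S] :
    (IsSemilocalAlgebra S → IsSkolemNoetherAlgebra.{w} F S) ∧
    (IsArtinianRing S ∨ IsArtinianRing Sᵐᵒᵖ → IsSkolemNoetherAlgebra.{w} F S) ∧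
    (FiniteDimensional F S → IsSkolemNoetherAlgebra.{w} F S) := by
  refine ⟨fun h ↦ h.isSkolemNoetherAlgebra F, ?_, fun h ↦ ?_⟩
  · rintro (h | h)
    · exact (IsSemilocalAlgebra.of_isArtinianRing S).isSkolemNoetherAlgebra F
    · exact (IsSemilocalAlgebra.of_isArtinianRing Sᵐᵒᵖ).of_mulOpposite.isSkolemNoetherAlgebra F
  · have : IsArtinianRing S := isArtinian_of_tower F inferInstance
    exact (IsSemilocalAlgebra.of_isArtinianRing S).isSkolemNoetherAlgebra F
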